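/- Let $A$ be a Boolean algebra and $Y$ a set. Let $X=\mathrm{Spec}\,A$ be the Stone locale of $A$, whose frame of opens $\Omega X$ is the frame $\mathrm{Idl}\,A$ of ideals of $A$, and regard $Y$ as the discrete locale whose frame of opens is the powerset $\mathcal P Y$. Call $\theta\subseteq Y\times A$ (written $y\,\theta\,a$) a *map relation* if for all $y,y'\in Y$ and $a,a'\in A$: 1. if $y\,\theta\,a$ and $a'\le a$ then $y\,\theta\,a'$; 2. $y\,\theta\,0$; 3. if $y\,\theta\,a$ and $y\,\theta\,a'$ then $y\,\theta\,(a\vee a')$; 4. if $y\,\theta\,a$ and $y'\,\theta\,a'$ then $a\wedge a'=0$ or $y=y'$; 5. there is a finite $\theta_0\subseteq\theta$ with $\bigvee_{y\theta_0 a}a=1$. Let $F$ be the set of those finite subsets $\phi_0\subseteq Y\times A$ that satisfy $\bigvee_{y\phi_0 a}a=1$ and condition (4) with $\phi_0$ in place of $\theta$. For a finite $\phi_0\subseteq Y\times A$ let $\overline{\phi}_0\subseteq Y\times A$ be the relation with $y\,\overline{\phi}_0\,a$ if and only if there is a finite $I\subseteq\phi_0$ such that $z=y$ for all $(z,b)\in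 I$ and $a\le\bigvee_{(z,b)\in I}b$. For $\theta_0,\phi_0\in F$ write $\theta_0\equiv\phi_0$ if $\theta_0\subseteq\overline{\phi}_0$. Then: (a) Sending a map of locales $f:X\to Y$ to $\theta_f=\{(y,a)\mid a\in f^*(\{y\})\}$, where $f^*:\mathcal P Y\to\mathrm{Idl}\,A$ is the inverse image frame homomorphism of $f$, is a bijection from the set of maps $X\to Y$ to the set of map relations. (b) For each $\phi_0\in F$, $\overline{\phi}_0$ is a map relation containing $\phi_0$. Every map relation $\theta$ contains some $\theta_0\in F$, and $\theta=\overline{\theta}_0$ for every finite $\theta_0\subseteq\theta$ with $\bigvee_{y\theta_0 a}a=1$. (c) $\equiv$ is an equivalence relation on $F$, and $\theta_0\equiv\phi_0$ if and only if $\overline{\theta}_0=\overline{\phi}_0$. (d) The exponential $Y^X$ exists in the category of locales and is discrete, on the quotient set $F/{\equiv}$. That is, for $E=F/{\equiv}$ regarded as a discrete locale, there is a map $\mathrm{ev}:E\times X\to Y$ such that for every locale $Z$ and every map $f:Z\times X\to Y$ there is a unique map $g:Z\to E$ with $\mathrm{ev}\circ(g\times\mathrm{id}_X)=f$. Moreover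 $\mathrm{ev}$ can be chosen such that, for each $\theta_0\in F$, the map $X\to Y$ obtained by composing $\mathrm{ev}$ with $(c,\mathrm{id}_X):X\to E\times X$, where $c$ is the constant map with value the class $[\theta_0]$, has map relation $\overline{\theta}_0$. -/

import Mathlib

open CategoryTheory CategoryTheory.Limits

universe u

namespace StoneExp

/-! ### Binary products of locales

The coproduct of two frames `L` and `M` is built as the frame of those lower sets of `L × M`
that are closed under joins in each coordinate separately. -/

section FrameCoproduct

variable {L M N : Type u} [Order.Frame L] [Order.Frame M] [Order.Frame N]

lemma mem_himp_iff {P : Type u} [Preorder P] (U V : LowerSet P) (p : P) :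
    p ∈ U ⇨ V ↔ ∀ q ≤ p, q ∈ U → q ∈ V := by
  have h : p ∈ U ⇨ V ↔ LowerSet.Iic p ≤ U ⇨ V := LowerSet.Iic_le.symm
  rw [h, le_himp_iff]
  constructor
  · intro h q hq hU
    exact h ⟨hq, hU⟩
  · rintro h q ⟨hq, hU⟩
    exact h q hq hU

/-- Closure of a lower set of `L × M` under (arbitrary, also empty) joins in each coordinate. -/
def IsBiclosed (U : LowerSet (L × M)) : Prop :=
  (∀ (s : Set L) (b : M), (∀ a ∈ s, (a, b) ∈ U) → (sSup s, b) ∈ U) ∧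
  (∀ (a : L) (t : Set M), (∀ b ∈ t, (a, b) ∈ U) → (a, sSup t) ∈ U)

variable (L M) in
/-- The sublocale of the frame of lower sets of `L × M` whose frame of opens is the coproduct of
the frames `L` and `M`. -/
def coprodSublocale : Sublocale (LowerSet (L × M)) where
  carrier := {U | IsBiclosed U}
  sInf_mem' S hS := by
    refine ⟨fun s b h => ?_, fun a t h => ?_⟩
    · rw [LowerSet.mem_sInf_iff]
      intro U hU
      exact (hS hU).1 s b fun a ha => LowerSet.mem_sInf_iff.1 (h a ha) U hU
    · rw [LowerSet.mem_sInf_iff]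
      intro U hU
      exact (hS hU).2 a t fun b hb => LowerSet.mem_sInf_iff.1 (h b hb) U hU
  himp_mem' U V hV := by
    refine ⟨fun s b h => ?_, fun a t h => ?_⟩
    · rw [mem_himp_iff]
      rintro ⟨c, d⟩ ⟨hc, hd⟩ hU
      have hc' : c = sSup ((fun a => c ⊓ a) '' s) := by
        rw [sSup_image, ← inf_sSup_eq]
        exact (inf_eq_left.2 hc).symm
      rw [hc']
      refine hV.1 _ _ ?_
      rintro _ ⟨a, ha, rfl⟩
      exact (mem_himp_iff U V _).1 (h a ha) _ ⟨inf_le_right, hd⟩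
        (U.lower (Prod.mk_le_mk.2 ⟨inf_le_left, le_rfl⟩ : (c ⊓ a, d) ≤ (c, d)) hU)
    · rw [mem_himp_iff]
      rintro ⟨c, d⟩ ⟨hc, hd⟩ hU
      have hd' : d = sSup ((fun b => d ⊓ b) '' t) := by
        rw [sSup_image, ← inf_sSup_eq]
        exact (inf_eq_left.2 hd).symm
      rw [hd']
      refine hV.2 _ _ ?_
      rintro _ ⟨b, hb, rfl⟩
      exact (mem_himp_iff U V _).1 (h b hb) _ ⟨hc, inf_le_right⟩
        (U.lower (Prod.mk_le_mk.2 ⟨le_rfl, inf_le_left⟩ : (c, d ⊓ b) ≤ (c, d)) hU)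

variable (L M) in
/-- The coproduct frame of `L` and `M`. -/
abbrev FrameCoprod : Type u := coprodSublocale L M

lemma FrameCoprod.closed (U : FrameCoprod L M) : IsBiclosed U.1 := U.2

lemma FrameCoprod.bot_left (U : FrameCoprod L M) (b : M) : ((⊥ : L), b) ∈ U.1 := by
  simpa using U.closed.1 ∅ b (by simp)

lemma FrameCoprod.bot_right (U : FrameCoprod L M) (a : L) : (a, (⊥ : M)) ∈ U.1 := by
  simpa using U.closed.2 a ∅ (by simp)

lemma sSup_eq_bot_of {P : Type u} [CompleteLattice P] {s : Set P} (h : ∀ a ∈ s, a = ⊥) :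
    sSup s = ⊥ := sSup_eq_bot.2 h

/-- The open `a × 1`. -/
def inlOpen (a : L) : FrameCoprod L M :=
  ⟨⟨{p | p.1 ≤ a ∨ p.2 = ⊥}, by
      rintro ⟨x, y⟩ ⟨x', y'⟩ ⟨hx, hy⟩ (h | h)
      · exact Or.inl (hx.trans h)
      · exact Or.inr (le_bot_iff.1 (hy.trans_eq h))⟩, by
    refine ⟨fun s b h => ?_, fun x t h => ?_⟩
    · by_cases hb : b = ⊥
      · exact Or.inr hb
      · exact Or.inl (sSup_le fun c hc => (h c hc).resolve_right hb)
    · by_cases hx : x ≤ a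
      · exact Or.inl hx
      · exact Or.inr (sSup_eq_bot_of fun c hc => (h c hc).resolve_left hx)⟩

/-- The open `1 × b`. -/
def inrOpen (b : M) : FrameCoprod L M :=
  ⟨⟨{p | p.2 ≤ b ∨ p.1 = ⊥}, by
      rintro ⟨x, y⟩ ⟨x', y'⟩ ⟨hx, hy⟩ (h | h)
      · exact Or.inl (hy.trans h)
      · exact Or.inr (le_bot_iff.1 (hx.trans_eq h))⟩, by
    refine ⟨fun s y h => ?_, fun x t h => ?_⟩
    · by_cases hy : y ≤ b
      · exact Or.inl hy
      · exact Or.inr (sSup_eq_bot_of fun c hc => (h c hc).resolve_left hy)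
    · by_cases hx : x = ⊥
      · exact Or.inr hx
      · exact Or.inl (sSup_le fun c hc => (h c hc).resolve_right hx)⟩

lemma mem_inlOpen (a : L) (p : L × M) : p ∈ (inlOpen a : FrameCoprod L M).1 ↔
    p.1 ≤ a ∨ p.2 = ⊥ := Iff.rfl

lemma mem_inrOpen (b : M) (p : L × M) : p ∈ (inrOpen b : FrameCoprod L M).1 ↔
    p.2 ≤ b ∨ p.1 = ⊥ := Iff.rfl

lemma mem_inf (U V : FrameCoprod L M) (p : L × M) :
    p ∈ (U ⊓ V).1 ↔ p ∈ U.1 ∧ p ∈ V.1 := Iff.rfl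

lemma mem_top (p : L × M) : p ∈ (⊤ : FrameCoprod L M).1 := trivial

lemma le_def (U V : FrameCoprod L M) : U ≤ V ↔ ∀ p ∈ U.1, p ∈ V.1 := Iff.rfl

variable (L M) in
/-- The first coproduct injection. -/
def inlHom : FrameHom L (FrameCoprod L M) where
  toFun := inlOpen
  map_inf' a b := by
    refine Subtype.ext (LowerSet.ext (Set.ext fun p => ?_))
    change (p.1 ≤ a ⊓ b ∨ p.2 = ⊥) ↔ (p.1 ≤ a ∨ p.2 = ⊥) ∧ (p.1 ≤ b ∨ p.2 = ⊥)
    rw [le_inf_iff]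
    tauto
  map_top' := by
    refine Subtype.ext (LowerSet.ext (Set.ext fun p => ?_))
    exact iff_of_true (Or.inl le_top) trivial
  map_sSup' s := by
    apply le_antisymm
    · rintro ⟨x, y⟩ h
      rcases h with h | h
      · refine LowerSet.lower _ (Prod.mk_le_mk.2 ⟨h, le_rfl⟩ : (x, y) ≤ (sSup s, y)) ?_
        refine (FrameCoprod.closed _).1 s y fun a ha => ?_
        exact (le_def _ _).1 (le_sSup (Set.mem_image_of_mem inlOpen ha)) _ (Or.inl le_rfl)
      · obtain rfl : y = ⊥ := h
        exact FrameCoprod.bot_right _ x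
    · refine sSup_le ?_
      rintro _ ⟨a, ha, rfl⟩ p (h | h)
      · exact Or.inl (h.trans (le_sSup ha))
      · exact Or.inr h

variable (L M) in
/-- The second coproduct injection. -/
def inrHom : FrameHom M (FrameCoprod L M) where
  toFun := inrOpen
  map_inf' a b := by
    refine Subtype.ext (LowerSet.ext (Set.ext fun p => ?_))
    change (p.2 ≤ a ⊓ b ∨ p.1 = ⊥) ↔ (p.2 ≤ a ∨ p.1 = ⊥) ∧ (p.2 ≤ b ∨ p.1 = ⊥)
    rw [le_inf_iff]
    tauto
  map_top' := by
    refine Subtype.ext (LowerSet.ext (Set.ext fun p => ?_))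
    exact iff_of_true (Or.inl le_top) trivial
  map_sSup' s := by
    apply le_antisymm
    · rintro ⟨x, y⟩ h
      rcases h with h | h
      · refine LowerSet.lower _ (Prod.mk_le_mk.2 ⟨le_rfl, h⟩ : (x, y) ≤ (x, sSup s)) ?_
        refine (FrameCoprod.closed _).2 x s fun a ha => ?_
        exact (le_def _ _).1 (le_sSup (Set.mem_image_of_mem inrOpen ha)) _ (Or.inl le_rfl)
      · obtain rfl : x = ⊥ := h
        exact FrameCoprod.bot_left _ y
    · refine sSup_le ?_
      rintro _ ⟨a, ha, rfl⟩ p (h | h)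
      · exact Or.inl (h.trans (le_sSup ha))
      · exact Or.inr h

/-- Every open of the coproduct is the join of the open rectangles that it contains. -/
lemma eq_sSup_rect (U : FrameCoprod L M) :
    U = sSup ((fun p : L × M => inlHom L M p.1 ⊓ inrHom L M p.2) '' {p | p ∈ U.1}) := by
  apply le_antisymm
  · intro p hp
    exact (le_def _ _).1 (le_sSup (Set.mem_image_of_mem
      (fun p : L × M => inlHom L M p.1 ⊓ inrHom L M p.2) (show p ∈ {p | p ∈ U.1} from hp))) _
      ⟨Or.inl le_rfl, Or.inl le_rfl⟩
  · refine sSup_le ?_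
    rintro _ ⟨⟨a, b⟩, hp, rfl⟩ ⟨x, y⟩ ⟨h1, h2⟩
    rcases h1 with h1 | h1
    · rcases h2 with h2 | h2
      · exact U.1.lower (Prod.mk_le_mk.2 ⟨h1, h2⟩) hp
      · obtain rfl : x = ⊥ := h2
        exact FrameCoprod.bot_left _ y
    · obtain rfl : y = ⊥ := h1
      exact FrameCoprod.bot_right _ x

/-- The open of elements `(a, b)` with `f a ∧ g b ≤ n`. -/
def copairAdj (f : FrameHom L N) (g : FrameHom M N) (n : N) : FrameCoprod L M :=
  ⟨⟨{p | f p.1 ⊓ g p.2 ≤ n}, by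
      rintro ⟨x, y⟩ ⟨x', y'⟩ ⟨hx, hy⟩ h
      exact (inf_le_inf (OrderHomClass.mono f hx) (OrderHomClass.mono g hy)).trans h⟩, by
    refine ⟨fun s b h => ?_, fun a t h => ?_⟩
    · change f (sSup s) ⊓ g b ≤ n
      rw [map_sSup, sSup_inf_eq]
      simp only [iSup_le_iff, Set.mem_image, forall_exists_index, and_imp]
      rintro _ a ha rfl
      exact h a ha
    · change f a ⊓ g (sSup t) ≤ n
      rw [map_sSup, inf_sSup_eq]
      simp only [iSup_le_iff, Set.mem_image, forall_exists_index, and_imp]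
      rintro _ a ha rfl
      exact h a ha⟩

/-- The function underlying the copairing of two frame homomorphisms. -/
def copairFun (f : FrameHom L N) (g : FrameHom M N) (U : FrameCoprod L M) : N :=
  sSup ((fun p : L × M => f p.1 ⊓ g p.2) '' {p | p ∈ U.1})

lemma copair_gc (f : FrameHom L N) (g : FrameHom M N) :
    GaloisConnection (copairFun f g) (copairAdj f g) := by
  intro U n
  rw [copairFun, sSup_le_iff, le_def]
  constructor
  · exact fun h p hp => h _ ⟨p, hp, rfl⟩
  · rintro h _ ⟨p, hp, rfl⟩
    exact h p hp

/-- The copairing of two frame homomorphisms. -/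
def copair (f : FrameHom L N) (g : FrameHom M N) : FrameHom (FrameCoprod L M) N where
  toFun := copairFun f g
  map_inf' U V := by
    apply le_antisymm
    · exact le_inf ((copair_gc f g).monotone_l inf_le_left)
        ((copair_gc f g).monotone_l inf_le_right)
    · simp only [copairFun]
      rw [sSup_inf_sSup]
      simp only [iSup_le_iff]
      rintro ⟨_, _⟩ ⟨⟨p, hp, rfl⟩, ⟨q, hq, rfl⟩⟩
      refine le_trans ?_ (le_sSup ⟨p ⊓ q, ⟨U.1.lower inf_le_left hp, V.1.lower inf_le_right hq⟩,
        rfl⟩)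
      change f p.1 ⊓ g p.2 ⊓ (f q.1 ⊓ g q.2) ≤ f (p.1 ⊓ q.1) ⊓ g (p.2 ⊓ q.2)
      rw [map_inf, map_inf, inf_inf_inf_comm]
  map_top' := by
    refine top_le_iff.1 (le_sSup ⟨⊤, mem_top _, ?_⟩)
    change f ⊤ ⊓ g ⊤ = ⊤
    simp
  map_sSup' s := by
    rw [(copair_gc f g).l_sSup, sSup_image]

lemma copair_inl (f : FrameHom L N) (g : FrameHom M N) (a : L) :
    copair f g (inlHom L M a) = f a := by
  apply le_antisymm
  · refine ((copair_gc f g) _ _).2 ?_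
    rintro ⟨x, y⟩ (h | h)
    · exact inf_le_left.trans (OrderHomClass.mono f h)
    · change f x ⊓ g y ≤ f a
      obtain rfl : y = ⊥ := h
      simp
  · refine le_sSup ⟨(a, ⊤), Or.inl le_rfl, ?_⟩
    simp

lemma copair_inr (f : FrameHom L N) (g : FrameHom M N) (b : M) :
    copair f g (inrHom L M b) = g b := by
  apply le_antisymm
  · refine ((copair_gc f g) _ _).2 ?_
    rintro ⟨x, y⟩ (h | h)
    · exact inf_le_right.trans (OrderHomClass.mono g h)
    · change f x ⊓ g y ≤ g b
      obtain rfl : x = ⊥ := h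
      simp
  · refine le_sSup ⟨(⊤, b), Or.inl le_rfl, ?_⟩
    simp

lemma copair_unique (f : FrameHom L N) (g : FrameHom M N) (h : FrameHom (FrameCoprod L M) N)
    (hf : ∀ a, h (inlHom L M a) = f a) (hg : ∀ b, h (inrHom L M b) = g b) :
    h = copair f g := by
  ext U
  rw [eq_sSup_rect U, map_sSup, map_sSup, Set.image_image, Set.image_image]
  congr 1
  refine Set.image_congr fun p _ => ?_
  rw [map_inf, map_inf, hf, hg, copair_inl, copair_inr]

end FrameCoproduct

/-- The coproduct cocone in the category of frames is a colimit. -/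
def frameCoprodIsColimit (F G : Frm.{u}) :
    IsColimit (BinaryCofan.mk (Frm.ofHom (inlHom F G)) (Frm.ofHom (inrHom F G)) :
      BinaryCofan F G) :=
  BinaryCofan.isColimitMk (fun s => Frm.ofHom (copair s.inl.hom s.inr.hom))
    (fun s => Frm.ext fun a => copair_inl s.inl.hom s.inr.hom a)
    (fun s => Frm.ext fun b => copair_inr s.inl.hom s.inr.hom b)
    (fun s m h₁ h₂ => Frm.hom_ext (copair_unique s.inl.hom s.inr.hom m.hom
      (fun a => by rw [← h₁]; rfl) (fun b => by rw [← h₂]; rfl)))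

instance : HasBinaryCoproducts Frm.{u} :=
  @hasBinaryCoproducts_of_hasColimit_pair _ _ fun {F G} =>
    ⟨⟨⟨_, frameCoprodIsColimit F G⟩⟩⟩

instance : HasBinaryProducts Locale.{u} :=
  inferInstanceAs (HasBinaryProducts Frm.{u}ᵒᵖ)

/-! ### Discrete locales, Stone locales, exponentials -/

/-- The inverse image frame homomorphism of a map of locales. -/
def inverseImage {X Y : Locale.{u}} (f : X ⟶ Y) : FrameHom Y X :=
  (Quiver.Hom.unop f).hom

/-- The discrete locale on a set `Y`: its frame of opens is the powerset of `Y`. -/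
def discrete (Y : Type u) : Locale.{u} :=
  Locale.of (Set Y)

/-- The frame of ideals of a Boolean algebra. -/
instance idealFrame (A : Type u) [BooleanAlgebra A] : Order.Frame (Order.Ideal A) :=
  Order.Frame.ofMinimalAxioms
    { inf_sSup_le_iSup_inf := by
        intro I S
        let T : Order.Ideal A := ⨆ J ∈ S, I ⊓ J
        have hK : Order.IsIdeal {x : A | ∀ i ∈ I, i ⊓ x ∈ T} :=
          { IsLowerSet := fun x y hyx hx i hi => T.lower (inf_le_inf_left i hyx) (hx i hi)
            Nonempty := ⟨⊥, fun i _ => by simp⟩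
            Directed := fun x hx y hy => ⟨x ⊔ y, fun i hi => by
              rw [inf_sup_left]
              exact Order.Ideal.sup_mem (hx i hi) (hy i hi), le_sup_left, le_sup_right⟩ }
        have hS : sSup S ≤ hK.toIdeal := by
          refine sSup_le fun J hJ x hx i hi => ?_
          have h : I ⊓ J ≤ T := le_iSup₂_of_le (f := fun J (_ : J ∈ S) => I ⊓ J) J hJ le_rfl
          exact h ⟨I.lower inf_le_left hi, J.lower inf_le_right hx⟩
        rintro x ⟨hxI, hxS⟩
        have := hS hxS x hxI
        rwa [inf_idem] at this }

/-- The Stone locale `Spec A` of a Boolean algebra `A`: its frame of opens is the ideal completion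
of `A`. -/
def spec (A : Type u) [BooleanAlgebra A] : Locale.{u} :=
  Locale.of (Order.Ideal A)

/-- The constant map from a locale `Z` to the discrete locale `Q` with value `q ∈ Q`: the inverse
image of `S ⊆ Q` is `⊤` if `q ∈ S`, and `⊥` otherwise. -/
def constMap (Z : Locale.{u}) {Q : Type u} (q : Q) : Z ⟶ discrete Q :=
  Quiver.Hom.op (Frm.ofHom (X := Set Q) (Y := Z)
    { toFun := fun S => ⨆ _ : q ∈ S, ⊤
      map_inf' := fun S T => by
        by_cases h : q ∈ S <;> by_cases h' : q ∈ T <;> simp [h, h']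
      map_top' := by simp
      map_sSup' := fun S => by
        apply le_antisymm
        · refine iSup_le fun h => ?_
          obtain ⟨T, hT, hq⟩ := Set.mem_sUnion.1 h
          exact le_sSup_of_le ⟨T, hT, rfl⟩ (by simp [hq])
        · refine sSup_le ?_
          rintro _ ⟨T, hT, rfl⟩
          exact iSup_le fun h => le_iSup_of_le (Set.mem_sUnion.2 ⟨T, hT, h⟩) le_rfl })

/-- `ev : E × X ⟶ Y` exhibits the locale `E` as the exponential `Y^X`. -/
def IsExponential {X Y E : Locale.{u}} (ev : E ⨯ X ⟶ Y) : Prop :=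
  ∀ (Z : Locale.{u}) (f : Z ⨯ X ⟶ Y), ∃! g : Z ⟶ E, prod.map g (𝟙 X) ≫ ev = f

/-! ### Map relations -/

section MapRelation

variable {Y A : Type u} [BooleanAlgebra A]

/-- The relation between `Y` and `A` given by a map `f : Spec A ⟶ Y`: it relates `y` to `a` iff
`a` belongs to the ideal `f⁻¹ {y}`, i.e. iff `f` has value `y` on the clopen `a`. -/
def graph (f : spec A ⟶ discrete Y) : Set (Y × A) :=
  {p | p.2 ∈ (show Order.Ideal A from inverseImage f ({p.1} : Set Y))}

/-- Map relations `θ ⊆ Y × A`. -/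
structure IsMapRelation (θ : Set (Y × A)) : Prop where
  lower : ∀ y a a', (y, a) ∈ θ → a' ≤ a → (y, a') ∈ θ
  bot : ∀ y, (y, ⊥) ∈ θ
  sup : ∀ y a a', (y, a) ∈ θ → (y, a') ∈ θ → (y, a ⊔ a') ∈ θ
  single_valued : ∀ y a y' a', (y, a) ∈ θ → (y', a') ∈ θ → a ⊓ a' = ⊥ ∨ y = y'
  total : ∃ θ₀ : Finset (Y × A), ↑θ₀ ⊆ θ ∧ θ₀.sup Prod.snd = ⊤

variable (Y A) in
/-- The finite subsets `φ₀` of `Y × A` whose second components have join `⊤` and that satisfy the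
single-valuedness condition of map relations. -/
def FinRel : Type u :=
  {φ₀ : Finset (Y × A) // φ₀.sup Prod.snd = ⊤ ∧
    ∀ y a y' a', (y, a) ∈ φ₀ → (y', a') ∈ φ₀ → a ⊓ a' = ⊥ ∨ y = y'}

/-- The relation `φ̄₀` generated by a finite subset `φ₀` of `Y × A`: it relates `y` to `a` iff `a`
is below the join of the second components of some finite `I ⊆ φ₀` all of whose first components
are `y`. -/
def generated (φ₀ : Finset (Y × A)) : Set (Y × A) :=
  {p | ∃ I : Finset (Y × A), I ⊆ φ₀ ∧ (∀ q ∈ I, p.1 = q.1) ∧ p.2 ≤ I.sup Prod.snd}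

/-- The relation `θ₀ ≡ φ₀`, i.e. `θ₀ ⊆ φ̄₀`. -/
def FinRel.Equiv (θ₀ φ₀ : FinRel Y A) : Prop :=
  (θ₀.1 : Set (Y × A)) ⊆ generated φ₀.1

end MapRelation

end StoneExp

/-!
A frame homomorphism out of a powerset `𝒫 Y` is the same thing as a partition of the top element
indexed by `Y` (`partitionHom`), and two such homomorphisms agree as soon as one lies below the
other on singletons (`powersetHom_ext_of_le`), because complements are preserved. For the frame of
ideals of `A`, compactness of the top ideal turns partitions into map relations; and a map relation
`θ` is generated by any finite `θ₀ ⊆ θ` that covers `⊤`, since `a = ⋁ a ⊓ b` over `(z, b) ∈ θ₀`,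
where only the terms with `z = y` survive when `(y, a) ∈ θ` (`IsMapRelation.eq_generated`).

For the exponential, an open `U` of `Z × Spec A` is determined by its extents: `extent U a` is the
largest open `z` of `Z` with `z × a ≤ U`. A map `f : Z × Spec A ⟶ Y` is a partition `(U y)` of the
top open of `Z × Spec A`. For a finite `φ ⊆ Y × A` the open `weight U φ = ⋀ extent (U y) a`, over
`(y, a) ∈ φ`, is the part of `Z` where the fibre of `f` is related by `φ`. Compactness of `Spec A`,
in the form `iSup_weight_eq_top_of_cover`, shows that the weights of the finite `φ` covering `⊤`
cover `Z`. A weight vanishes unless `φ` is single-valued, and the weight of an admissible `φ`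
depends only on its class, so the weights form a partition of the top open of `Z` indexed by the
quotient set: this is the transpose `Z ⟶ E` of `f`. The evaluation map is given by the partition
`⋁ e × {a | (y, a) ∈ θ_e}` over the classes `e` with map relations `θ_e`. Both the equation of the
transpose and its uniqueness reduce to inequalities on singletons, which are immediate from the
definition of the weights.
-/

namespace StoneExp

/-! ### Frame homomorphisms out of a powerset -/

section Powerset

variable {Y L : Type u} [Order.Frame L]

lemma powersetHom_apply (F : FrameHom (Set Y) L) (s : Set Y) : F s = ⨆ y ∈ s, F {y} := by
  have h : s = ⨆ y ∈ s, ({y} : Set Y) := by simp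
  conv_lhs => rw [h]
  simp only [map_iSup]

/-- Two partitions of the top element indexed by the same set are equal as soon as one refines the
other. -/
lemma powersetHom_ext_of_le {F G : FrameHom (Set Y) L} (h : ∀ y, F {y} ≤ G {y}) : F = G := by
  have hle : ∀ s, F s ≤ G s := fun s => by
    rw [powersetHom_apply F, powersetHom_apply G]
    exact iSup₂_mono fun y _ => h y
  ext s
  refine le_antisymm (hle s) ?_
  have h₁ : F s ⊔ F sᶜ = ⊤ := by rw [← map_sup, sup_compl_eq_top, map_top]
  have h₂ : G s ⊓ G sᶜ = ⊥ := by rw [← map_inf, inf_compl_eq_bot, map_bot]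
  calc G s = G s ⊓ (F s ⊔ F sᶜ) := by rw [h₁, inf_top_eq]
    _ = G s ⊓ F s ⊔ G s ⊓ F sᶜ := inf_sup_left _ _ _
    _ ≤ F s := sup_le inf_le_right
      (((inf_le_inf_left _ (hle sᶜ)).trans h₂.le).trans bot_le)

/-- The frame homomorphism on the powerset of `Y` given by a partition of the top element that is
indexed by `Y` (with members that may be `⊥`). -/
def partitionHom (u : Y → L) (hd : ∀ y y', y ≠ y' → u y ⊓ u y' = ⊥) (hc : ⨆ y, u y = ⊤) :
    FrameHom (Set Y) L where
  toFun s := ⨆ y ∈ s, u y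
  map_inf' s t := by
    apply le_antisymm
    · exact le_inf (iSup₂_le fun y hy => le_iSup₂_of_le y hy.1 le_rfl)
        (iSup₂_le fun y hy => le_iSup₂_of_le y hy.2 le_rfl)
    · simp only [iSup_inf_eq, inf_iSup_eq]
      refine iSup₂_le fun y' hy' => iSup₂_le fun y hy => ?_
      by_cases h : y = y'
      · subst h
        exact inf_le_left.trans (le_iSup₂_of_le (f := fun y (_ : y ∈ s ⊓ t) => u y) y
          ⟨hy, hy'⟩ le_rfl)
      · exact (hd _ _ h).le.trans bot_le
  map_top' := by simpa using hc
  map_sSup' S := by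
    rw [sSup_image]
    apply le_antisymm
    · refine iSup₂_le fun y hy => ?_
      obtain ⟨t, ht, hy⟩ := Set.mem_sUnion.1 hy
      exact le_iSup₂_of_le t ht (le_iSup₂_of_le y hy le_rfl)
    · exact iSup₂_le fun t ht => iSup₂_le fun y hy =>
        le_iSup₂_of_le y (Set.mem_sUnion.2 ⟨t, ht, hy⟩) le_rfl

lemma partitionHom_singleton (u : Y → L) (hd hc) (y : Y) :
    partitionHom u hd hc {y} = u y := by
  change ⨆ y' ∈ ({y} : Set Y), u y' = u y
  simp

end Powerset

/-! ### Map relations and the finite relations that generate them -/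

section Relations

variable {Y A : Type u} [BooleanAlgebra A]

lemma subset_generated (φ : Finset (Y × A)) : (φ : Set (Y × A)) ⊆ generated φ := by
  intro p hp
  exact ⟨{p}, by simpa using hp, by simp, by simp⟩

lemma IsMapRelation.sup_mem {θ : Set (Y × A)} (hθ : IsMapRelation θ) {y : Y}
    {I : Finset (Y × A)} (hI : ∀ q ∈ I, q ∈ θ) (hy : ∀ q ∈ I, y = q.1) :
    (y, I.sup Prod.snd) ∈ θ := by
  classical
  induction I using Finset.induction_on with
  | empty => exact hθ.bot y
  | insert q I _ ih =>
    rw [Finset.sup_insert]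
    refine hθ.sup _ _ _ ?_ (ih (fun r hr => hI r (Finset.mem_insert_of_mem hr))
      fun r hr => hy r (Finset.mem_insert_of_mem hr))
    rw [hy q (Finset.mem_insert_self q I)]
    exact hI q (Finset.mem_insert_self q I)

theorem IsMapRelation.eq_generated {θ : Set (Y × A)} (hθ : IsMapRelation θ)
    {θ₀ : Finset (Y × A)} (hsub : (θ₀ : Set (Y × A)) ⊆ θ) (htop : θ₀.sup Prod.snd = ⊤) :
    θ = generated θ₀ := by
  classical
  apply Set.Subset.antisymm
  · rintro ⟨y, a⟩ hya
    refine ⟨θ₀.filter fun q => y = q.1, Finset.filter_subset _ _, by simp, ?_⟩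
    change a ≤ _
    calc a = a ⊓ θ₀.sup Prod.snd := by rw [htop, inf_top_eq]
      _ = θ₀.sup fun q => a ⊓ q.2 := Finset.sup_inf_distrib_left _ _ _
      _ ≤ _ := Finset.sup_le fun q hq => by
        rcases hθ.single_valued y a q.1 q.2 hya (hsub hq) with h | h
        · exact h.le.trans bot_le
        · exact inf_le_right.trans
            (Finset.le_sup (f := Prod.snd) (Finset.mem_filter.2 ⟨hq, h⟩))
  · rintro ⟨y, a⟩ ⟨I, hI, hy, ha⟩
    exact hθ.lower _ _ _ (hθ.sup_mem (fun q hq => hsub (hI hq)) hy) ha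

theorem isMapRelation_generated (φ : FinRel Y A) : IsMapRelation (generated φ.1) where
  lower := by
    rintro y a a' ⟨I, hI, hy, ha⟩ h
    exact ⟨I, hI, hy, h.trans ha⟩
  bot y := ⟨∅, by simp, by simp, bot_le⟩
  sup := by
    classical
    rintro y a a' ⟨I, hI, hy, ha⟩ ⟨J, hJ, hy', ha'⟩
    refine ⟨I ∪ J, Finset.union_subset hI hJ, fun q hq => ?_, ?_⟩
    · rcases Finset.mem_union.1 hq with h | h
      exacts [hy q h, hy' q h]
    · rw [Finset.sup_union]
      exact sup_le_sup ha ha'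
  single_valued := by
    rintro y a y' a' ⟨I, hI, hy, ha⟩ ⟨J, hJ, hy', ha'⟩
    by_cases h : y = y'
    · exact Or.inr h
    left
    rw [← disjoint_iff]
    refine Disjoint.mono ha ha' (Finset.disjoint_sup_left.2 fun p hp =>
      Finset.disjoint_sup_right.2 fun q hq => disjoint_iff.2 ?_)
    refine (φ.2.2 p.1 p.2 q.1 q.2 (hI hp) (hJ hq)).resolve_right fun hpq => h ?_
    exact (hy p hp).trans (hpq.trans (hy' q hq).symm)
  total := ⟨φ.1, subset_generated _, φ.2.1⟩

theorem IsMapRelation.exists_finRel {θ : Set (Y × A)} (hθ : IsMapRelation θ) :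
    ∃ θ₀ : FinRel Y A, (θ₀.1 : Set (Y × A)) ⊆ θ := by
  obtain ⟨θ₀, hsub, htop⟩ := hθ.total
  exact ⟨⟨θ₀, htop, fun y a y' a' h h' => hθ.single_valued y a y' a' (hsub h) (hsub h')⟩, hsub⟩

theorem finRel_equiv_iff (θ φ : FinRel Y A) :
    FinRel.Equiv θ φ ↔ generated θ.1 = generated φ.1 :=
  ⟨fun h => ((isMapRelation_generated φ).eq_generated h θ.2.1).symm,
    fun h => (subset_generated θ.1).trans h.subset⟩

theorem finRel_equivalence : _root_.Equivalence (FinRel.Equiv (Y := Y) (A := A)) where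
  refl θ := (finRel_equiv_iff θ θ).2 rfl
  symm h := (finRel_equiv_iff _ _).2 ((finRel_equiv_iff _ _).1 h).symm
  trans h h' :=
    (finRel_equiv_iff _ _).2 (((finRel_equiv_iff _ _).1 h).trans ((finRel_equiv_iff _ _).1 h'))

variable (Y A) in
/-- The set of classes of admissible finite relations, whose discrete locale is the exponential. -/
abbrev FinRelClass : Type u := Quot (FinRel.Equiv (Y := Y) (A := A))

/-- The map relation generated by any representative of a class. -/
def FinRelClass.rel : FinRelClass Y A → Set (Y × A) :=
  Quot.lift (fun φ => generated φ.1) fun θ φ h => (finRel_equiv_iff θ φ).1 h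

lemma FinRelClass.isMapRelation_rel (e : FinRelClass Y A) : IsMapRelation e.rel := by
  induction e using Quot.ind with
  | mk φ => exact isMapRelation_generated φ

end Relations

/-! ### Map relations as partitions of the top ideal -/

section Ideals

variable {Y A : Type u} [BooleanAlgebra A]

lemma ideal_eq_bot_iff (I : Order.Ideal A) : I = ⊥ ↔ ∀ a ∈ I, a = ⊥ := by
  rw [← le_bot_iff]
  exact ⟨fun h a ha => le_bot_iff.1 (h ha), fun h a ha => (h a ha).le⟩

/-- The ideal of elements that a map relation relates to `y`. -/
def IsMapRelation.ideal {θ : Set (Y × A)} (hθ : IsMapRelation θ) (y : Y) : Order.Ideal A :=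
  Order.IsIdeal.toIdeal (I := {a | (y, a) ∈ θ})
    { IsLowerSet := fun a a' h ha => hθ.lower y a a' ha h
      Nonempty := ⟨⊥, hθ.bot y⟩
      Directed := fun a ha a' ha' => ⟨a ⊔ a', hθ.sup y a a' ha ha', le_sup_left, le_sup_right⟩ }

lemma IsMapRelation.mem_ideal {θ : Set (Y × A)} (hθ : IsMapRelation θ) {y : Y} {a : A} :
    a ∈ hθ.ideal y ↔ (y, a) ∈ θ := Iff.rfl

lemma IsMapRelation.ideal_disjoint {θ : Set (Y × A)} (hθ : IsMapRelation θ) (y y' : Y)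
    (h : y ≠ y') : hθ.ideal y ⊓ hθ.ideal y' = ⊥ := by
  rw [ideal_eq_bot_iff]
  rintro a ⟨ha, ha'⟩
  simpa using (hθ.single_valued y a y' a ha ha').resolve_right h

lemma IsMapRelation.iSup_ideal {θ : Set (Y × A)} (hθ : IsMapRelation θ) :
    ⨆ y, hθ.ideal y = ⊤ := by
  obtain ⟨θ₀, hsub, htop⟩ := hθ.total
  rw [eq_top_iff]
  intro a _
  refine (⨆ y, hθ.ideal y).lower (le_top.trans_eq htop.symm) ?_
  refine Finset.sup_induction (Order.Ideal.bot_mem _)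
    (fun a ha b hb => Order.Ideal.sup_mem ha hb) fun q hq => ?_
  exact le_iSup hθ.ideal q.1 (hsub hq)

/-- The map `Spec A ⟶ Y` with a given map relation. -/
def IsMapRelation.toMap {θ : Set (Y × A)} (hθ : IsMapRelation θ) : spec A ⟶ discrete Y :=
  Quiver.Hom.op (Frm.ofHom (X := Set Y) (Y := Order.Ideal A)
    (partitionHom hθ.ideal hθ.ideal_disjoint hθ.iSup_ideal))

lemma inverseImage_toMap {θ : Set (Y × A)} (hθ : IsMapRelation θ) (y : Y) :
    inverseImage hθ.toMap ({y} : Set Y) = hθ.ideal y :=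
  partitionHom_singleton hθ.ideal hθ.ideal_disjoint hθ.iSup_ideal y

theorem graph_toMap {θ : Set (Y × A)} (hθ : IsMapRelation θ) : graph hθ.toMap = θ := by
  ext ⟨y, a⟩
  change a ∈ (show Order.Ideal A from inverseImage hθ.toMap ({y} : Set Y)) ↔ _
  rw [inverseImage_toMap]
  exact hθ.mem_ideal

/-- A join of ideals is the top ideal only if finitely many members of the ideals have join `⊤`. -/
lemma exists_finset_of_iSup_eq_top (u : Y → Order.Ideal A) (hu : ⨆ y, u y = ⊤) :
    ∃ θ₀ : Finset (Y × A), (∀ p ∈ θ₀, p.2 ∈ u p.1) ∧ θ₀.sup Prod.snd = ⊤ := by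
  classical
  have hK : Order.IsIdeal {a : A | ∃ θ₀ : Finset (Y × A),
      (∀ p ∈ θ₀, p.2 ∈ u p.1) ∧ a ≤ θ₀.sup Prod.snd} :=
    { IsLowerSet := fun a a' h ⟨θ₀, h₁, h₂⟩ => ⟨θ₀, h₁, le_trans h h₂⟩
      Nonempty := ⟨⊥, ∅, by simp, bot_le⟩
      Directed := by
        rintro a ⟨θ₀, h₁, h₂⟩ a' ⟨θ₁, h₁', h₂'⟩
        refine ⟨a ⊔ a', ⟨θ₀ ∪ θ₁, fun p hp => ?_, ?_⟩, le_sup_left, le_sup_right⟩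
        · rcases Finset.mem_union.1 hp with h | h
          exacts [h₁ p h, h₁' p h]
        · rw [Finset.sup_union]
          exact sup_le_sup h₂ h₂' }
  have h : ⨆ y, u y ≤ hK.toIdeal := iSup_le fun y a ha => ⟨{(y, a)}, by simpa using ha, by simp⟩
  obtain ⟨θ₀, h₁, h₂⟩ := h (hu ▸ trivial : (⊤ : A) ∈ ⨆ y, u y)
  exact ⟨θ₀, h₁, top_le_iff.1 h₂⟩

theorem isMapRelation_graph (f : spec A ⟶ discrete Y) : IsMapRelation (graph f) := by
  let F : FrameHom (Set Y) (Order.Ideal A) := inverseImage f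
  have hmem : ∀ y a, (y, a) ∈ graph f ↔ a ∈ F {y} := fun _ _ => Iff.rfl
  refine ⟨fun y a a' h hle => (F {y}).lower hle h, fun y => (F {y}).bot_mem,
    fun y a a' h h' => Order.Ideal.sup_mem h h', fun y a y' a' h h' => ?_, ?_⟩
  · by_cases hy : y = y'
    · exact Or.inr hy
    left
    have hF : F {y} ⊓ F {y'} = ⊥ := by
      rw [← map_inf, ← map_bot F]
      congr 1
      exact Set.singleton_inter_eq_empty.2 hy
    exact (ideal_eq_bot_iff _).1 hF _ ⟨(F {y}).lower inf_le_left h, (F {y'}).lower inf_le_right h'⟩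
  · have hF : ⨆ y, F {y} = ⊤ := by
      rw [← map_top F, powersetHom_apply F ⊤]
      simp
    obtain ⟨θ₀, h₁, h₂⟩ := exists_finset_of_iSup_eq_top (fun y => F {y}) hF
    exact ⟨θ₀, fun p hp => h₁ p hp, h₂⟩

/-- Maps into a discrete locale are determined by the inverse images of points; an inequality
between these suffices. -/
lemma map_ext_of_le {Z : Locale.{u}} {f g : Z ⟶ discrete Y}
    (h : ∀ y, inverseImage f ({y} : Set Y) ≤ inverseImage g ({y} : Set Y)) : f = g :=
  Quiver.Hom.unop_inj (Frm.hom_ext (powersetHom_ext_of_le (Y := Y) h))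

theorem bijOn_graph : Set.BijOn (fun f : spec A ⟶ discrete Y => graph f) Set.univ
    {θ : Set (Y × A) | IsMapRelation θ} := by
  refine ⟨fun f _ => isMapRelation_graph f, fun f _ g _ h => map_ext_of_le fun y a ha => ?_,
    fun θ hθ => ⟨IsMapRelation.toMap hθ, trivial, graph_toMap hθ⟩⟩
  exact (h.subset ha : (y, a) ∈ graph g)

end Ideals

/-! ### Opens of the product of a locale with a Stone locale -/

section Extent

variable {L A Y : Type u} [Order.Frame L] [BooleanAlgebra A]

lemma sSup_principal (I : Order.Ideal A) : sSup (Order.Ideal.principal '' (I : Set A)) = I := by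
  apply le_antisymm
  · refine sSup_le ?_
    rintro _ ⟨a, ha, rfl⟩
    exact Order.Ideal.principal_le_iff.2 ha
  · intro a ha
    exact (le_sSup (Set.mem_image_of_mem _ ha) : Order.Ideal.principal a ≤ _)
      Order.Ideal.mem_principal_self

/-- The largest `z` such that the rectangle `z × a` is contained in `U`. -/
def extent (U : FrameCoprod L (Order.Ideal A)) (a : A) : L :=
  sSup {z | (z, Order.Ideal.principal a) ∈ U.1}

lemma le_extent_iff (U : FrameCoprod L (Order.Ideal A)) (z : L) (a : A) :
    z ≤ extent U a ↔ (z, Order.Ideal.principal a) ∈ U.1 := by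
  refine ⟨fun h => ?_, fun h => le_sSup h⟩
  exact U.1.lower (Prod.mk_le_mk.2 ⟨h, le_rfl⟩) (U.closed.1 _ _ fun _ hz => hz)

lemma mem_iff_le_extent (U : FrameCoprod L (Order.Ideal A)) (z : L) (I : Order.Ideal A) :
    (z, I) ∈ U.1 ↔ ∀ a ∈ I, z ≤ extent U a := by
  constructor
  · intro h a ha
    rw [le_extent_iff]
    exact U.1.lower (Prod.mk_le_mk.2 ⟨le_rfl, Order.Ideal.principal_le_iff.2 ha⟩) h
  · intro h
    rw [← sSup_principal I]
    refine U.closed.2 _ _ ?_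
    rintro _ ⟨a, ha, rfl⟩
    exact (le_extent_iff _ _ _).1 (h a ha)

lemma extent_sup (U : FrameCoprod L (Order.Ideal A)) (a b : A) :
    extent U a ⊓ extent U b ≤ extent U (a ⊔ b) := by
  have h : (extent U a ⊓ extent U b, Order.Ideal.principal a ⊔ Order.Ideal.principal b) ∈ U.1 := by
    rw [← sSup_pair]
    refine U.closed.2 _ _ ?_
    rintro _ (rfl | rfl)
    · exact (le_extent_iff _ _ _).1 inf_le_left
    · exact (le_extent_iff _ _ _).1 inf_le_right
  exact (mem_iff_le_extent _ _ _).1 h _ (Order.Ideal.sup_mem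
    ((le_sup_left : _ ≤ Order.Ideal.principal a ⊔ Order.Ideal.principal b)
      Order.Ideal.mem_principal_self)
    ((le_sup_right : _ ≤ Order.Ideal.principal a ⊔ Order.Ideal.principal b)
      Order.Ideal.mem_principal_self))

lemma extent_anti (U : FrameCoprod L (Order.Ideal A)) {a b : A} (h : a ≤ b) :
    extent U b ≤ extent U a :=
  (mem_iff_le_extent U _ (Order.Ideal.principal b)).1 ((le_extent_iff _ _ _).1 le_rfl) a h

lemma extent_bot (U : FrameCoprod L (Order.Ideal A)) : extent U ⊥ = ⊤ := by
  rw [← top_le_iff, le_extent_iff, Order.Ideal.principal_bot]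
  exact U.bot_right _

lemma finset_inf_extent_le (U : FrameCoprod L (Order.Ideal A)) (I : Finset (Y × A)) :
    I.inf (fun p => extent U p.2) ≤ extent U (I.sup Prod.snd) := by
  classical
  induction I using Finset.induction_on with
  | empty => simp [extent_bot]
  | insert p I _ ih =>
    rw [Finset.inf_insert, Finset.sup_insert]
    exact (inf_le_inf_left _ ih).trans (extent_sup _ _ _)

/-- The least open consists of the degenerate rectangles only. -/
lemma mem_bot_iff {M : Type u} [Order.Frame M] (p : L × M) :
    p ∈ (⊥ : FrameCoprod L M).1 ↔ p.1 = ⊥ ∨ p.2 = ⊥ := by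
  constructor
  · intro h
    have h' : p ∈ (inlOpen ⊥ : FrameCoprod L M).1 :=
      (le_def _ _).1 (bot_le : (⊥ : FrameCoprod L M) ≤ inlOpen ⊥) p h
    exact h'.imp_left le_bot_iff.1
  · obtain ⟨x, y⟩ := p
    rintro (h | h)
    · obtain rfl : x = ⊥ := h
      exact FrameCoprod.bot_left _ _
    · obtain rfl : y = ⊥ := h
      exact FrameCoprod.bot_right _ _

lemma extent_inf_extent_eq_bot {U V : FrameCoprod L (Order.Ideal A)} (h : U ⊓ V = ⊥) {a b : A}
    (hab : a ⊓ b ≠ ⊥) : extent U a ⊓ extent V b = ⊥ := by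
  have hmem : (extent U a ⊓ extent V b, Order.Ideal.principal (a ⊓ b)) ∈ (U ⊓ V).1 :=
    ⟨(le_extent_iff _ _ _).1 (inf_le_left.trans (extent_anti U inf_le_left)),
      (le_extent_iff _ _ _).1 (inf_le_right.trans (extent_anti V inf_le_right))⟩
  rw [h, mem_bot_iff] at hmem
  refine hmem.resolve_right fun h' => hab ?_
  exact (ideal_eq_bot_iff _).1 h' _ Order.Ideal.mem_principal_self

/-- The largest `z` such that `z × a ≤ U y` for all `(y, a) ∈ φ`. -/
def weight (U : Y → FrameCoprod L (Order.Ideal A)) (φ : Finset (Y × A)) : L :=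
  φ.inf fun p => extent (U p.1) p.2

lemma weight_le_extent (U : Y → FrameCoprod L (Order.Ideal A)) {φ : Finset (Y × A)} {y : Y} {a : A}
    (h : (y, a) ∈ generated φ) : weight U φ ≤ extent (U y) a := by
  obtain ⟨I, hI, hy, ha⟩ := h
  refine le_trans ?_ ((finset_inf_extent_le (U y) I).trans (extent_anti _ ha))
  refine Finset.le_inf fun p hp => ?_
  have hp' : y = p.1 := hy p hp
  rw [hp']
  exact Finset.inf_le (f := fun p => extent (U p.1) p.2) (hI hp)

lemma weight_le_of_subset_generated (U : Y → FrameCoprod L (Order.Ideal A))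
    {θ φ : Finset (Y × A)} (h : (θ : Set (Y × A)) ⊆ generated φ) : weight U φ ≤ weight U θ :=
  Finset.le_inf fun _ hp => weight_le_extent U (h hp)

lemma weight_eq_bot_or (U : Y → FrameCoprod L (Order.Ideal A))
    (hd : ∀ y y', y ≠ y' → U y ⊓ U y' = ⊥) (φ : Finset (Y × A)) :
    weight U φ = ⊥ ∨
      ∀ y a y' a', (y, a) ∈ φ → (y', a') ∈ φ → a ⊓ a' = ⊥ ∨ y = y' := by
  by_contra! h
  obtain ⟨hw, y, a, y', a', ha, ha', hne, hy⟩ := h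
  have hle : ∀ p ∈ φ, weight U φ ≤ extent (U p.1) p.2 := fun p hp =>
    Finset.inf_le (f := fun p : Y × A => extent (U p.1) p.2) hp
  refine hw (le_bot_iff.1 ?_)
  rw [← extent_inf_extent_eq_bot (hd y y' hy) hne]
  exact le_inf (hle _ ha) (hle _ ha')

/-- Compactness of `Spec A`, relative to a second locale: a cover of the product is refined, locally
on the second locale, by finitely many clopens that cover `Spec A`. -/
theorem iSup_weight_eq_top_of_cover (U : Y → FrameCoprod L (Order.Ideal A)) (hc : ⨆ y, U y = ⊤) :
    ⨆ (φ : Finset (Y × A)) (_ : φ.sup Prod.snd = ⊤), weight U φ = ⊤ := by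
  classical
  -- The rectangles `z × I` such that `z` is covered by weights of finite relations covering `a`,
  -- for each `a ∈ I`, form an open; it contains every `U y`, hence the rectangle `⊤ × ⊤`.
  let P : A → L := fun a => ⨆ (φ : Finset (Y × A)) (_ : a ≤ φ.sup Prod.snd), weight U φ
  have hP : ∀ (φ : Finset (Y × A)) (a : A), a ≤ φ.sup Prod.snd → weight U φ ≤ P a :=
    fun φ a h => le_iSup₂_of_le (f := fun φ (_ : a ≤ Finset.sup φ Prod.snd) => weight U φ)
      φ h le_rfl
  have hanti : ∀ a b, a ≤ b → P b ≤ P a := fun a b h =>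
    iSup₂_le fun φ hφ => hP φ a (h.trans hφ)
  have hsup : ∀ a b, P a ⊓ P b ≤ P (a ⊔ b) := fun a b => by
    simp only [P, iSup_inf_eq, inf_iSup_eq]
    refine iSup₂_le fun ψ hψ => iSup₂_le fun φ hφ => ?_
    refine le_trans (le_of_eq ?_) (hP (φ ∪ ψ) _ ?_)
    · simp only [weight, Finset.inf_union]
    · rw [Finset.sup_union]
      exact sup_le_sup hφ hψ
  have hI : ∀ z : L, Order.IsIdeal {a | z ≤ P a} := fun z =>
    { IsLowerSet := fun a b h ha => le_trans ha (hanti b a h)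
      Nonempty := ⟨⊥, le_top.trans ((by simp [weight] : (⊤ : L) ≤ weight U ∅).trans
        (hP ∅ ⊥ bot_le))⟩
      Directed := fun a ha b hb =>
        ⟨a ⊔ b, (le_inf ha hb).trans (hsup a b), le_sup_left, le_sup_right⟩ }
  let V : FrameCoprod L (Order.Ideal A) :=
    ⟨⟨{p | p.2 ≤ (hI p.1).toIdeal}, by
        rintro ⟨z, I⟩ ⟨z', I'⟩ ⟨hz, hI'⟩ h a ha
        exact le_trans hz (h (hI' ha))⟩, by
      refine ⟨fun s I h a ha => ?_, fun z t h => ?_⟩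
      · exact sSup_le fun z hz => h z hz ha
      · change sSup t ≤ (hI z).toIdeal
        exact sSup_le h⟩
  have hUV : ⨆ y, U y ≤ V := by
    refine iSup_le fun y => ?_
    rintro ⟨z, I⟩ h a ha
    refine ((mem_iff_le_extent _ _ _).1 h a ha).trans (le_trans ?_ (hP {(y, a)} a (by simp)))
    simp [weight]
  have htop : ((⊤ : L), (⊤ : Order.Ideal A)) ∈ V.1 := by
    rw [hc] at hUV
    exact (le_def _ _).1 hUV _ (mem_top _)
  have h : (⊤ : L) ≤ P ⊤ := htop (trivial : (⊤ : A) ∈ (⊤ : Order.Ideal A))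
  simpa [P, top_le_iff] using h

/-- The weight of the representatives of a class. -/
def classWeight (U : Y → FrameCoprod L (Order.Ideal A)) : FinRelClass Y A → L :=
  Quot.lift (fun φ => weight U φ.1) fun _ _ h => le_antisymm
    (weight_le_of_subset_generated U (finRel_equivalence.symm h))
    (weight_le_of_subset_generated U h)

lemma classWeight_disjoint (U : Y → FrameCoprod L (Order.Ideal A))
    (hd : ∀ y y', y ≠ y' → U y ⊓ U y' = ⊥) (e e' : FinRelClass Y A) (h : e ≠ e') :
    classWeight U e ⊓ classWeight U e' = ⊥ := by
  classical
  induction e using Quot.ind with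
  | mk φ =>
  induction e' using Quot.ind with
  | mk ψ =>
  have hw : weight U φ.1 ⊓ weight U ψ.1 = weight U (φ.1 ∪ ψ.1) := Finset.inf_union.symm
  change weight U φ.1 ⊓ weight U ψ.1 = ⊥
  rw [hw]
  refine (weight_eq_bot_or U hd _).resolve_right fun hs => h ?_
  -- Otherwise the union is admissible, and equivalent to both relations.
  let χ : FinRel Y A := ⟨φ.1 ∪ ψ.1, by rw [Finset.sup_union, φ.2.1, top_sup_eq], hs⟩
  have h₁ : FinRel.Equiv φ χ := fun p hp =>
    subset_generated χ.1 (Finset.mem_union_left _ hp)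
  have h₂ : FinRel.Equiv ψ χ := fun p hp =>
    subset_generated χ.1 (Finset.mem_union_right _ hp)
  exact (Quot.sound h₁).trans (Quot.sound h₂).symm

lemma iSup_classWeight (U : Y → FrameCoprod L (Order.Ideal A))
    (hd : ∀ y y', y ≠ y' → U y ⊓ U y' = ⊥) (hc : ⨆ y, U y = ⊤) :
    ⨆ e : FinRelClass Y A, classWeight U e = ⊤ := by
  rw [← top_le_iff, ← iSup_weight_eq_top_of_cover U hc]
  refine iSup₂_le fun φ hφ => ?_
  rcases weight_eq_bot_or U hd φ with h | h
  · exact h.le.trans bot_le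
  · exact le_iSup (classWeight U) (Quot.mk _ ⟨φ, hφ, h⟩)

end Extent

/-! ### The evaluation map -/

section Evaluation

variable {Y A : Type u} [BooleanAlgebra A]

/-- The inverse image of the point `y` under evaluation: the join over all classes `e` of the
rectangles `{e} × {a | (y, a) ∈ e.rel}`. -/
def evalOpen (A : Type u) [BooleanAlgebra A] (y : Y) :
    FrameCoprod (Set (FinRelClass Y A)) (Order.Ideal A) :=
  ⨆ e : FinRelClass Y A, inlHom (Set (FinRelClass Y A)) (Order.Ideal A) {e} ⊓
    inrHom (Set (FinRelClass Y A)) (Order.Ideal A) (e.isMapRelation_rel.ideal y)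

lemma evalOpen_disjoint (y y' : Y) (h : y ≠ y') : evalOpen A y ⊓ evalOpen A y' = ⊥ := by
  rw [← le_bot_iff]
  simp only [evalOpen, iSup_inf_eq, inf_iSup_eq]
  refine iSup_le fun e' => iSup_le fun e => ?_
  rw [inf_inf_inf_comm, ← map_inf, ← map_inf]
  by_cases he : e = e'
  · subst he
    rw [e.isMapRelation_rel.ideal_disjoint _ _ h, map_bot, inf_bot_eq]
  · have hb : ({e} ⊓ {e'} : Set (FinRelClass Y A)) = ⊥ := Set.singleton_inter_eq_empty.2 he
    rw [hb, map_bot, bot_inf_eq]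

lemma iSup_evalOpen : ⨆ y : Y, evalOpen A y = ⊤ := by
  simp only [evalOpen]
  rw [iSup_comm]
  have h : ∀ e : FinRelClass Y A,
      ⨆ y, inlHom (Set (FinRelClass Y A)) (Order.Ideal A) {e} ⊓
        inrHom (Set (FinRelClass Y A)) (Order.Ideal A) (e.isMapRelation_rel.ideal y) =
      inlHom (Set (FinRelClass Y A)) (Order.Ideal A) {e} := fun e => by
    rw [← inf_iSup_eq, ← map_iSup, e.isMapRelation_rel.iSup_ideal, map_top, inf_top_eq]
  simp only [h]
  rw [← map_iSup, ← map_top (inlHom (Set (FinRelClass Y A)) (Order.Ideal A))]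
  congr 1
  exact Set.iUnion_of_singleton _

variable (Y A) in
/-- The inverse image homomorphism of the evaluation map. -/
def evalHom : FrameHom (Set Y) (FrameCoprod (Set (FinRelClass Y A)) (Order.Ideal A)) :=
  partitionHom (evalOpen A) evalOpen_disjoint iSup_evalOpen

lemma copair_evalHom {N : Type u} [Order.Frame N] (F : FrameHom (Set (FinRelClass Y A)) N)
    (G : FrameHom (Order.Ideal A) N) (y : Y) :
    copair F G (evalHom Y A {y}) =
      ⨆ e : FinRelClass Y A, F {e} ⊓ G (e.isMapRelation_rel.ideal y) := by
  rw [evalHom, partitionHom_singleton, evalOpen, map_iSup]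
  simp only [map_inf, copair_inl, copair_inr]

variable {L : Type u} [Order.Frame L]

/-- The universal property of the evaluation map, in terms of frame homomorphisms. -/
theorem existsUnique_transpose (F : FrameHom (Set Y) (FrameCoprod L (Order.Ideal A))) :
    ∃! G : FrameHom (Set (FinRelClass Y A)) L,
      (copair ((inlHom L (Order.Ideal A)).comp G) (inrHom L (Order.Ideal A))).comp
        (evalHom Y A) = F := by
  let U : Y → FrameCoprod L (Order.Ideal A) := fun y => F {y}
  have hd : ∀ y y', y ≠ y' → U y ⊓ U y' = ⊥ := fun y y' h => by
    rw [← map_inf, ← map_bot F]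
    congr 1
    exact Set.singleton_inter_eq_empty.2 h
  have hc : ⨆ y, U y = ⊤ := by
    rw [← map_top F, powersetHom_apply F ⊤]
    simp [U]
  -- The left hand side on `{y}` is below `U y` iff each rectangle in the join is.
  have key : ∀ (G : FrameHom (Set (FinRelClass Y A)) L) (y : Y),
      (copair ((inlHom L (Order.Ideal A)).comp G) (inrHom L (Order.Ideal A))).comp
        (evalHom Y A) {y} ≤ U y ↔
      ∀ (e : FinRelClass Y A) (a : A), (y, a) ∈ e.rel → G {e} ≤ extent (U y) a := fun G y => by
    rw [FrameHom.comp_apply, copair_evalHom, iSup_le_iff]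
    refine forall_congr' fun e => ?_
    have hr : ∀ (z : L) (I : Order.Ideal A) (V : FrameCoprod L (Order.Ideal A)),
        inlHom L (Order.Ideal A) z ⊓ inrHom L (Order.Ideal A) I ≤ V ↔ (z, I) ∈ V.1 := by
      intro z I V
      refine ⟨fun h => (le_def _ _).1 h _ ⟨Or.inl le_rfl, Or.inl le_rfl⟩, fun h => ?_⟩
      rw [eq_sSup_rect V]
      exact le_sSup ⟨(z, I), h, rfl⟩
    rw [FrameHom.comp_apply, hr, mem_iff_le_extent]
    exact Iff.rfl
  refine ⟨partitionHom (classWeight U) (classWeight_disjoint U hd) (iSup_classWeight U hd hc),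
    powersetHom_ext_of_le fun y => (key _ y).2 fun e a ha => ?_,
    fun G hG => powersetHom_ext_of_le fun e => ?_⟩
  · rw [partitionHom_singleton]
    induction e using Quot.ind with
    | mk φ => exact weight_le_extent U ha
  · rw [partitionHom_singleton]
    induction e using Quot.ind with
    | mk φ =>
    refine Finset.le_inf fun p hp => ?_
    refine (key G p.1).1 (by rw [hG]) _ p.2 ?_
    exact subset_generated φ.1 hp

end Evaluation

/-! ### Passage to the category of locales -/

section Locale

/-- The product of two locales, given by the coproduct frame. -/
def locProd (Z X : Locale.{u}) : Locale.{u} :=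
  Locale.of (FrameCoprod Z X)

/-- The first projection. -/
def locFst (Z X : Locale.{u}) : locProd Z X ⟶ Z :=
  Quiver.Hom.op (Frm.ofHom (X := Z) (Y := FrameCoprod Z X) (inlHom Z X))

/-- The second projection. -/
def locSnd (Z X : Locale.{u}) : locProd Z X ⟶ X :=
  Quiver.Hom.op (Frm.ofHom (X := X) (Y := FrameCoprod Z X) (inrHom Z X))

/-- The map into the product given by the copairing of the inverse images. -/
def locPair {W Z X : Locale.{u}} (f : W ⟶ Z) (g : W ⟶ X) : W ⟶ locProd Z X :=
  Quiver.Hom.op (Frm.ofHom (X := FrameCoprod Z X) (Y := W)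
    (copair (inverseImage f) (inverseImage g)))

lemma locPair_fst {W Z X : Locale.{u}} (f : W ⟶ Z) (g : W ⟶ X) :
    locPair f g ≫ locFst Z X = f :=
  Quiver.Hom.unop_inj (Frm.ext fun a => copair_inl (inverseImage f) (inverseImage g) a)

lemma locPair_snd {W Z X : Locale.{u}} (f : W ⟶ Z) (g : W ⟶ X) :
    locPair f g ≫ locSnd Z X = g :=
  Quiver.Hom.unop_inj (Frm.ext fun a => copair_inr (inverseImage f) (inverseImage g) a)

lemma locProd_hom_ext {W Z X : Locale.{u}} {h k : W ⟶ locProd Z X}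
    (h₁ : h ≫ locFst Z X = k ≫ locFst Z X) (h₂ : h ≫ locSnd Z X = k ≫ locSnd Z X) : h = k := by
  have key : ∀ m : W ⟶ locProd Z X, m = locPair (m ≫ locFst Z X) (m ≫ locSnd Z X) := fun m =>
    Quiver.Hom.unop_inj (Frm.hom_ext (copair_unique (inverseImage (m ≫ locFst Z X))
      (inverseImage (m ≫ locSnd Z X)) (inverseImage m) (fun _ => rfl) (fun _ => rfl)))
  rw [key h, key k, h₁, h₂]

/-- The comparison of the chosen product of locales with the one given by the coproduct frame. -/
noncomputable def locProdIso (Z X : Locale.{u}) : Z ⨯ X ≅ locProd Z X where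
  hom := locPair prod.fst prod.snd
  inv := prod.lift (locFst Z X) (locSnd Z X)
  hom_inv_id := by
    apply Limits.prod.hom_ext
    · rw [Category.assoc, prod.lift_fst, locPair_fst, Category.id_comp]
    · rw [Category.assoc, prod.lift_snd, locPair_snd, Category.id_comp]
  inv_hom_id := by
    apply locProd_hom_ext
    · rw [Category.assoc, locPair_fst, prod.lift_fst, Category.id_comp]
    · rw [Category.assoc, locPair_snd, prod.lift_snd, Category.id_comp]

lemma locProdIso_fst (Z X : Locale.{u}) : (locProdIso Z X).hom ≫ locFst Z X = prod.fst :=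
  locPair_fst _ _

lemma locProdIso_snd (Z X : Locale.{u}) : (locProdIso Z X).hom ≫ locSnd Z X = prod.snd :=
  locPair_snd _ _

lemma prodLift_locProdIso {W Z X : Locale.{u}} (f : W ⟶ Z) (g : W ⟶ X) :
    prod.lift f g ≫ (locProdIso Z X).hom = locPair f g := by
  apply locProd_hom_ext
  · rw [Category.assoc, locProdIso_fst, prod.lift_fst, locPair_fst]
  · rw [Category.assoc, locProdIso_snd, prod.lift_snd, locPair_snd]

lemma prodMap_locProdIso {Z E X : Locale.{u}} (g : Z ⟶ E) :
    prod.map g (𝟙 X) ≫ (locProdIso E X).hom =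
      (locProdIso Z X).hom ≫ locPair (locFst Z X ≫ g) (locSnd Z X) := by
  apply locProd_hom_ext
  · rw [Category.assoc, Category.assoc, locProdIso_fst, locPair_fst, prod.map_fst,
      ← locProdIso_fst, Category.assoc]
  · rw [Category.assoc, Category.assoc, locProdIso_snd, locPair_snd, prod.map_snd,
      locProdIso_snd, Category.comp_id]

variable (Y A : Type u) [BooleanAlgebra A]

/-- Evaluation, as a map out of the product given by the coproduct frame. -/
def locEval : locProd (discrete (FinRelClass Y A)) (spec A) ⟶ discrete Y :=
  Quiver.Hom.op (Frm.ofHom (X := Set Y)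
    (Y := FrameCoprod (Set (FinRelClass Y A)) (Order.Ideal A)) (evalHom Y A))

/-- The evaluation map of the exponential of `discrete Y` by `spec A`. -/
noncomputable def eval : discrete (FinRelClass Y A) ⨯ spec A ⟶ discrete Y :=
  (locProdIso _ _).hom ≫ locEval Y A

theorem isExponential_eval : IsExponential (eval Y A) := by
  intro Z f
  have hiff : ∀ g : Z ⟶ discrete (FinRelClass Y A), prod.map g (𝟙 (spec A)) ≫ eval Y A = f ↔
      (copair ((inlHom Z (Order.Ideal A)).comp (inverseImage g)) (inrHom Z (Order.Ideal A))).comp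
        (evalHom Y A) = inverseImage ((locProdIso Z (spec A)).inv ≫ f) := fun g => by
    rw [eval, ← Category.assoc, prodMap_locProdIso, Category.assoc, ← Iso.eq_inv_comp]
    constructor
    · intro h
      rw [← h]
      rfl
    · intro h
      exact Quiver.Hom.unop_inj (Frm.hom_ext h)
  obtain ⟨G, hG, huniq⟩ := existsUnique_transpose (Y := Y) (A := A) (L := Z)
    (inverseImage ((locProdIso Z (spec A)).inv ≫ f))
  refine ⟨Quiver.Hom.op (Frm.ofHom (X := Set (FinRelClass Y A)) (Y := Z) G), (hiff _).2 hG,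
    fun g hg => ?_⟩
  exact Quiver.Hom.unop_inj (Frm.hom_ext (huniq (inverseImage g) ((hiff g).1 hg)))

theorem graph_eval (θ₀ : FinRel Y A) :
    graph (prod.lift (constMap (spec A) (Quot.mk FinRel.Equiv θ₀)) (𝟙 (spec A)) ≫ eval Y A) =
      generated θ₀.1 := by
  have h : (isMapRelation_generated θ₀).toMap =
      prod.lift (constMap (spec A) (Quot.mk FinRel.Equiv θ₀)) (𝟙 (spec A)) ≫ eval Y A := by
    rw [eval, ← Category.assoc, prodLift_locProdIso]
    refine map_ext_of_le fun y => ?_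
    rw [inverseImage_toMap]
    let c : FrameHom (Set (FinRelClass Y A)) (Order.Ideal A) :=
      inverseImage (constMap (spec A) (Quot.mk FinRel.Equiv θ₀))
    change _ ≤ copair c (FrameHom.id (Order.Ideal A)) (evalHom Y A {y})
    rw [copair_evalHom]
    refine le_iSup_of_le (Quot.mk FinRel.Equiv θ₀) (le_inf (le_top.trans ?_) le_rfl)
    exact le_iSup (fun _ : Quot.mk FinRel.Equiv θ₀ ∈ ({Quot.mk FinRel.Equiv θ₀} :
      Set (FinRelClass Y A)) => (⊤ : Order.Ideal A)) rfl
  rw [← h, graph_toMap]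

end Locale

end StoneExp

theorem proposition9p2 (A Y : Type u) [BooleanAlgebra A] :
    -- maps `Spec A ⟶ Y` correspond to map relations
    Set.BijOn (fun f : StoneExp.spec A ⟶ StoneExp.discrete Y => StoneExp.graph f) Set.univ
      {θ : Set (Y × A) | StoneExp.IsMapRelation θ} ∧
    -- each admissible finite `φ₀` generates a map relation that contains it
    (∀ φ₀ : StoneExp.FinRel Y A,
      StoneExp.IsMapRelation (StoneExp.generated φ₀.1) ∧
        (φ₀.1 : Set (Y × A)) ⊆ StoneExp.generated φ₀.1) ∧
    -- each map relation contains an admissible finite subset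
    (∀ θ : Set (Y × A), StoneExp.IsMapRelation θ →
      ∃ θ₀ : StoneExp.FinRel Y A, (θ₀.1 : Set (Y × A)) ⊆ θ) ∧
    -- and is determined by any finite subset as in the totality condition
    (∀ θ : Set (Y × A), StoneExp.IsMapRelation θ →
      ∀ θ₀ : Finset (Y × A), (θ₀ : Set (Y × A)) ⊆ θ → θ₀.sup Prod.snd = ⊤ →
        θ = StoneExp.generated θ₀) ∧
    -- `≡` is an equivalence relation, identifying the `θ₀`s that generate the same map relation
    _root_.Equivalence (StoneExp.FinRel.Equiv (Y := Y) (A := A)) ∧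
    (∀ θ₀ φ₀ : StoneExp.FinRel Y A, StoneExp.FinRel.Equiv θ₀ φ₀ ↔
      StoneExp.generated θ₀.1 = StoneExp.generated φ₀.1) ∧
    -- the exponential exists, and is the discrete locale on the quotient by `≡`, with the class of
    -- `θ₀` being the map `Spec A ⟶ Y` whose map relation is generated by `θ₀`
    ∃ ev : StoneExp.discrete (Quot (StoneExp.FinRel.Equiv (Y := Y) (A := A))) ⨯ StoneExp.spec A ⟶
        StoneExp.discrete Y,
      StoneExp.IsExponential ev ∧
      ∀ θ₀ : StoneExp.FinRel Y A,
        StoneExp.graph (prod.lift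
          (StoneExp.constMap (StoneExp.spec A) (Quot.mk StoneExp.FinRel.Equiv θ₀))
          (𝟙 (StoneExp.spec A)) ≫ ev) = StoneExp.generated θ₀.1 :=
  ⟨StoneExp.bijOn_graph,
    fun φ₀ => ⟨StoneExp.isMapRelation_generated φ₀, StoneExp.subset_generated φ₀.1⟩,
    fun _ hθ => hθ.exists_finRel,
    fun _ hθ _ hsub htop => hθ.eq_generated hsub htop,
    StoneExp.finRel_equivalence, StoneExp.finRel_equiv_iff,
    StoneExp.eval Y A, StoneExp.isExponential_eval Y A, StoneExp.graph_eval Y A⟩
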